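/- Let $F$ be an arbitrary field. For a Lie algebra $L$ over $F$ write $L^2=[L,L]$ and let $Z(L)$ be its centre. The (non-abelian) tensor square $L\otimes L$ is the Lie algebra over $F$ generated by the symbols $x\otimes y$ ($x,y\in L$) subject to the relations, for all $c\in F$ and $x,x',y,y'\in L$: (i) $c(x\otimes y)=cx\otimes y=x\otimes cy$; (ii) $(x+x')\otimes y=x\otimes y+x'\otimes y$ and $x\otimes(y+y')=x\otimes y+x\otimes y'$; (iii) $[x,x']\otimes y=x\otimes[x',y]-x'\otimes[x,y]$ and $x\otimes[y,y']=[y',x]\otimes y-[y,x]\otimes y'$; (iv) $[x\otimes y,\,x'\otimes y']=-[y,x]\otimes[x',y']$. A Heisenberg Lie algebra is a finite dimensional Lie algebra $L$ with $L^2=Z(L)$ and $\dim L^2=1$; $H(m)$ denotes a Heisenberg Lie algebra of dimension $2m+1$ over $F$. **Proposition.** If $m\ge 2$, then there is an isomorphism of Lie algebras $$H(m)\otimes H(m)\;\cong\; H(m)/H(m)^2\otimes H(m)/H(m)^2,$$ and $\dim\bigl(H(m)\otimes H(m)\bigr)=4m^2$. If $m=1$, then $H(1)\otimes H(1)$ is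 an abelian Lie algebra of dimension $6$. -/

import Mathlib

noncomputable section

/-- The defining relations of the (non-abelian) tensor product `M ⊗ N` of two Lie algebras over `F`
acting on each other. An action of `M` on `N` (a bilinear map `(m, n) ↦ ᵐn` which is compatible
with the bracket of `M` and acts by derivations of `N`) is a Lie algebra homomorphism from `M` to
the derivations of `N`; here `α m n` is `ᵐn` and `β n m` is `ⁿm`. The generator of the free Lie
algebra at the pair `(m, n)` stands for the symbol `m ⊗ n`. -/
inductive LieTensorProduct.Rel {F M N : Type*} [Field F] [LieRing M] [LieAlgebra F M]
    [LieRing N] [LieAlgebra F N]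
    (α : M →ₗ⁅F⁆ LieDerivation F N N) (β : N →ₗ⁅F⁆ LieDerivation F M M) :
    FreeLieAlgebra F (M × N) → FreeLieAlgebra F (M × N) → Prop
  | smul_left (c : F) (m : M) (n : N) :
      Rel α β (c • FreeLieAlgebra.of F (m, n)) (FreeLieAlgebra.of F (c • m, n))
  | smul_right (c : F) (m : M) (n : N) :
      Rel α β (c • FreeLieAlgebra.of F (m, n)) (FreeLieAlgebra.of F (m, c • n))
  | add_left (m m' : M) (n : N) :
      Rel α β (FreeLieAlgebra.of F (m + m', n))
        (FreeLieAlgebra.of F (m, n) + FreeLieAlgebra.of F (m', n))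
  | add_right (m : M) (n n' : N) :
      Rel α β (FreeLieAlgebra.of F (m, n + n'))
        (FreeLieAlgebra.of F (m, n) + FreeLieAlgebra.of F (m, n'))
  | lie_left (m m' : M) (n : N) :
      Rel α β (FreeLieAlgebra.of F (⁅m, m'⁆, n))
        (FreeLieAlgebra.of F (m, α m' n) - FreeLieAlgebra.of F (m', α m n))
  | lie_right (m : M) (n n' : N) :
      Rel α β (FreeLieAlgebra.of F (m, ⁅n, n'⁆))
        (FreeLieAlgebra.of F (β n' m, n) - FreeLieAlgebra.of F (β n m, n'))
  | lie_lie (m m' : M) (n n' : N) :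
      Rel α β ⁅FreeLieAlgebra.of F (m, n), FreeLieAlgebra.of F (m', n')⁆
        (-FreeLieAlgebra.of F (β n m, α m' n'))

/-- The (non-abelian) tensor product `M ⊗ N` of two Lie algebras acting on each other: the Lie
algebra generated by the symbols `m ⊗ n` subject to the relations `LieTensorProduct.Rel`. -/
abbrev LieTensorProduct {F M N : Type*} [Field F] [LieRing M] [LieAlgebra F M]
    [LieRing N] [LieAlgebra F N]
    (α : M →ₗ⁅F⁆ LieDerivation F N N) (β : N →ₗ⁅F⁆ LieDerivation F M M) : Type _ :=
  FreeLieAlgebra F (M × N) ⧸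
    LieSubmodule.lieSpan F (FreeLieAlgebra F (M × N))
      {x | ∃ a b, LieTensorProduct.Rel α β a b ∧ x = a - b}

/-- The tensor square `L ⊗ L`: all actions are given by the Lie bracket of `L`. -/
abbrev LieTensorSquare (F L : Type*) [Field F] [LieRing L] [LieAlgebra F L] : Type _ :=
  LieTensorProduct (LieDerivation.ad F L) (LieDerivation.ad F L)

/-- The derived subalgebra `L² = [L, L]`, as an ideal of `L`. -/
abbrev derivedIdeal (F L : Type*) [Field F] [LieRing L] [LieAlgebra F L] : LieIdeal F L :=
  ⁅(⊤ : LieIdeal F L), (⊤ : LieIdeal F L)⁆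

/-- A Heisenberg Lie algebra: finite dimensional, with `L² = Z(L)` and `dim L² = 1`. -/
structure IsHeisenberg (F L : Type*) [Field F] [LieRing L] [LieAlgebra F L] : Prop where
  finiteDimensional : FiniteDimensional F L
  derivedIdeal_eq_center : derivedIdeal F L = LieAlgebra.center F L
  finrank_derivedIdeal : Module.finrank F (derivedIdeal F L) = 1

end

/-! Relation (iv) makes the symbols x ⊗ y span the tensor square linearly, so only bilinear
bookkeeping remains: spanning symbols are a basis as soon as a bilinear map respecting the relations
provides their coordinates (`isLieAbelian_and_nonempty_equiv`). For m ≥ 2, a central z can be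
written as a multiple of [a, b] with a, b commuting with any prescribed y, so relation (iii) gives z
⊗ y = y ⊗ z = 0 (`tmul_eq_zero`). Both tensor squares are then abelian, with the (2m)² symbols of a
basis of L/L² as basis. For m = 1, with basis x, y, z = [x, y], relation (iii) gives only z ⊗ z = 0,
x ⊗ z = -z ⊗ x and y ⊗ z = -z ⊗ y, which leaves six symbols. -/

theorem lie_mem_of_mem_span {F T : Type*} [CommRing F] [LieRing T] [LieAlgebra F T]
    {s : Set T} {S : Submodule F T} (h : ∀ a ∈ s, ∀ b ∈ s, ⁅a, b⁆ ∈ S) {a b : T}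
    (ha : a ∈ Submodule.span F s) (hb : b ∈ Submodule.span F s) : ⁅a, b⁆ ∈ S := by
  induction ha using Submodule.span_induction with
  | mem a ha =>
    induction hb using Submodule.span_induction with
    | mem b hb => exact h a ha b hb
    | zero => simp
    | add b c _ _ hb hc => rw [lie_add]; exact S.add_mem hb hc
    | smul t b _ hb => rw [lie_smul]; exact S.smul_mem t hb
  | zero => simp
  | add a c _ _ ha hc => rw [add_lie]; exact S.add_mem ha hc
  | smul t a _ ha => rw [smul_lie]; exact S.smul_mem t ha

/-! ### Tensor squares of arbitrary Lie algebras. -/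

namespace LieTensorSquare

variable {F L : Type*} [Field F] [LieRing L] [LieAlgebra F L]

/-- The generator `x ⊗ y` of the tensor square. -/
noncomputable def tmul (F : Type*) {L : Type*} [Field F] [LieRing L] [LieAlgebra F L] (x y : L) :
    LieTensorSquare F L :=
  LieSubmodule.Quotient.mk (FreeLieAlgebra.of F (x, y))

theorem mk_eq_of_rel {a b : FreeLieAlgebra F (L × L)}
    (h : LieTensorProduct.Rel (LieDerivation.ad F L) (LieDerivation.ad F L) a b) :
    (LieSubmodule.Quotient.mk a : LieTensorSquare F L) = LieSubmodule.Quotient.mk b := by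
  refine (Submodule.Quotient.eq _).2 ?_
  exact LieSubmodule.subset_lieSpan ⟨a, b, h, rfl⟩

theorem tmul_smul_left (c : F) (x y : L) : tmul F (c • x) y = c • tmul F x y :=
  (mk_eq_of_rel (.smul_left c x y)).symm

theorem tmul_smul_right (c : F) (x y : L) : tmul F x (c • y) = c • tmul F x y :=
  (mk_eq_of_rel (.smul_right c x y)).symm

theorem tmul_add_left (x x' y : L) : tmul F (x + x') y = tmul F x y + tmul F x' y :=
  mk_eq_of_rel (.add_left x x' y)

theorem tmul_add_right (x y y' : L) : tmul F x (y + y') = tmul F x y + tmul F x y' :=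
  mk_eq_of_rel (.add_right x y y')

theorem tmul_lie_left (x x' y : L) :
    tmul F ⁅x, x'⁆ y = tmul F x ⁅x', y⁆ - tmul F x' ⁅x, y⁆ :=
  by
  have h := mk_eq_of_rel (F := F) (.lie_left x x' y)
  simp only [LieDerivation.ad_apply_apply] at h
  exact h

theorem tmul_lie_right (x y y' : L) :
    tmul F x ⁅y, y'⁆ = tmul F ⁅y', x⁆ y - tmul F ⁅y, x⁆ y' :=
  by
  have h := mk_eq_of_rel (F := F) (.lie_right x y y')
  simp only [LieDerivation.ad_apply_apply] at h
  exact h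

theorem lie_tmul_tmul (x y x' y' : L) :
    ⁅tmul F x y, tmul F x' y'⁆ = -tmul F ⁅y, x⁆ ⁅x', y'⁆ :=
  by
  have h := mk_eq_of_rel (F := F) (.lie_lie x x' y y')
  simp only [LieDerivation.ad_apply_apply] at h
  exact h

/-- `tmul` as a bilinear map. -/
noncomputable def tmulₗ (F L : Type*) [Field F] [LieRing L] [LieAlgebra F L] :
    L →ₗ[F] L →ₗ[F] LieTensorSquare F L :=
  LinearMap.mk₂ F (tmul F) tmul_add_left tmul_smul_left tmul_add_right tmul_smul_right

@[simp]
theorem tmulₗ_apply (x y : L) : tmulₗ F L x y = tmul F x y := rfl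

/-- By relation (iv) the span is a Lie subalgebra. The quotient map from the free Lie algebra
factors through it, since this holds on generators, and is surjective. -/
theorem span_tmul :
    Submodule.span F (Set.range fun p : L × L => tmul F p.1 p.2) = ⊤ := by
  set S := Submodule.span F (Set.range fun p : L × L => tmul F p.1 p.2)
  have hmem (x y : L) : tmul F x y ∈ S := Submodule.subset_span ⟨(x, y), rfl⟩
  have hgen : ∀ a ∈ Set.range fun p : L × L => tmul F p.1 p.2,
      ∀ b ∈ Set.range fun p : L × L => tmul F p.1 p.2, ⁅a, b⁆ ∈ S := by
    rintro _ ⟨⟨x, y⟩, rfl⟩ _ ⟨⟨x', y'⟩, rfl⟩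
    simp only [lie_tmul_tmul]
    exact S.neg_mem (hmem _ _)
  let S' : LieSubalgebra F (LieTensorSquare F L) := { S with lie_mem' := fun ha hb => lie_mem_of_mem_span hgen ha hb }
  let g : FreeLieAlgebra F (L × L) →ₗ⁅F⁆ S' :=
    FreeLieAlgebra.lift F fun p => ⟨tmul F p.1 p.2, hmem _ _⟩
  let π : FreeLieAlgebra F (L × L) →ₗ⁅F⁆ LieTensorSquare F L :=
    { (Submodule.mkQ _ : FreeLieAlgebra F (L × L) →ₗ[F] LieTensorSquare F L) with
      map_lie' := fun {_ _} => rfl }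
  have hπ : S'.incl.comp g = π := by
    ext p
    simp only [LieHom.comp_apply, g, FreeLieAlgebra.lift_of_apply]
    rfl
  refine (Submodule.eq_top_iff').2 fun t => ?_
  obtain ⟨a, rfl⟩ := Submodule.mkQ_surjective _ t
  have : S'.incl (g a) = π a := by rw [← hπ]; rfl
  exact (this ▸ (g a).2 : π a ∈ S')

theorem isLieAbelian (h : ∀ x y x' y' : L, tmul F ⁅y, x⁆ ⁅x', y'⁆ = 0) :
    IsLieAbelian (LieTensorSquare F L) := by
  have hgen : ∀ a ∈ Set.range fun p : L × L => tmul F p.1 p.2,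
      ∀ b ∈ Set.range fun p : L × L => tmul F p.1 p.2,
      ⁅a, b⁆ ∈ (⊥ : Submodule F (LieTensorSquare F L)) := by
    rintro _ ⟨⟨x, y⟩, rfl⟩ _ ⟨⟨x', y'⟩, rfl⟩
    simp [lie_tmul_tmul, h]
  exact ⟨fun a b => (Submodule.mem_bot F).1 <|
    lie_mem_of_mem_span hgen (by simp [span_tmul]) (by simp [span_tmul])⟩

/-- A bilinear map compatible with the relations of the tensor square, and killing the pairs that
occur in its brackets, factors through the tensor square. -/
theorem exists_linearMap_tmul {A : Type*} [AddCommGroup A] [Module F A] (f : L →ₗ[F] L →ₗ[F] A)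
    (hleft : ∀ x x' y : L, f ⁅x, x'⁆ y = f x ⁅x', y⁆ - f x' ⁅x, y⁆)
    (hright : ∀ x y y' : L, f x ⁅y, y'⁆ = f ⁅y', x⁆ y - f ⁅y, x⁆ y')
    (hlie : ∀ x y x' y' : L, f ⁅y, x⁆ ⁅x', y'⁆ = 0) :
    ∃ φ : LieTensorSquare F L →ₗ[F] A, ∀ x y, φ (tmul F x y) = f x y := by
  -- With the zero bracket on `A`, the universal property of the free Lie algebra applies; `hlie` is
  -- then what relation (iv) requires.
  let : LieRing A :=
    { bracket := fun _ _ => 0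
      add_lie := by simp
      lie_add := by simp
      lie_self := by simp
      leibniz_lie := by simp }
  have h0 (a b : A) : ⁅a, b⁆ = 0 := rfl
  let : LieAlgebra F A := { lie_smul := by simp [h0] }
  let g : FreeLieAlgebra F (L × L) →ₗ⁅F⁆ A := FreeLieAlgebra.lift F fun p => f p.1 p.2
  have hg (p : L × L) : g (FreeLieAlgebra.of F p) = f p.1 p.2 :=
    FreeLieAlgebra.lift_of_apply _ _
  have hle : LieSubmodule.lieSpan F (FreeLieAlgebra F (L × L)) {x | ∃ a b,
      LieTensorProduct.Rel (LieDerivation.ad F L) (LieDerivation.ad F L) a b ∧ x = a - b}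
      ≤ g.ker := by
    rw [LieSubmodule.lieSpan_le]
    rintro _ ⟨a, b, h, rfl⟩
    change a - b ∈ g.ker
    rw [LieHom.mem_ker, map_sub, sub_eq_zero]
    cases h with
    | smul_left c m n => simp [hg]
    | smul_right c m n => simp [hg]
    | add_left m m' n => simp [hg]
    | add_right m n n' => simp [hg]
    | lie_left m m' n => simpa [hg] using hleft m m' n
    | lie_right m n n' => simpa [hg] using hright m n n'
    | lie_lie m m' n n' =>
      rw [LieHom.map_lie, h0, map_neg, hg]
      simpa using hlie m n m' n'
  exact ⟨Submodule.liftQ _ (g : FreeLieAlgebra F (L × L) →ₗ[F] A) hle, fun x y => hg (x, y)⟩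

/-- If the coordinates `f x y k` of `x ⊗ y` with respect to a family of symbols `p k ⊗ q k` are
compatible with the defining relations, then these symbols form a basis of the tensor square. -/
theorem isLieAbelian_and_nonempty_equiv {κ : Type*} [Fintype κ] [DecidableEq κ]
    (f : L →ₗ[F] L →ₗ[F] (κ → F)) (p q : κ → L)
    (hleft : ∀ x x' y : L, f ⁅x, x'⁆ y = f x ⁅x', y⁆ - f x' ⁅x, y⁆)
    (hright : ∀ x y y' : L, f x ⁅y, y'⁆ = f ⁅y', x⁆ y - f ⁅y, x⁆ y')
    (hlie : ∀ x y x' y' : L, f ⁅y, x⁆ ⁅x', y'⁆ = 0)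
    (hpq : ∀ k, f (p k) (q k) = Pi.single k 1)
    (hsum : ∀ x y, tmul F x y = ∑ k, f x y k • tmul F (p k) (q k)) :
    IsLieAbelian (LieTensorSquare F L) ∧ Nonempty (LieTensorSquare F L ≃ₗ[F] (κ → F)) := by
  refine ⟨isLieAbelian fun x y x' y' => by rw [hsum, hlie]; simp, ?_⟩
  obtain ⟨φ, hφ⟩ := exists_linearMap_tmul f hleft hright hlie
  let g : (κ → F) →ₗ[F] LieTensorSquare F L :=
    Fintype.linearCombination F fun k => tmul F (p k) (q k)
  refine ⟨LinearEquiv.ofLinearMap φ g ?_ ?_⟩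
  · refine LinearMap.pi_ext' fun k => LinearMap.ext_ring ?_
    simp [g, hφ, hpq]
  · refine LinearMap.ext_on span_tmul ?_
    rintro _ ⟨⟨x, y⟩, rfl⟩
    simp [g, hφ, Fintype.linearCombination_apply, ← hsum]

/-- If `x ⊗ y` only depends on the images of `x` and `y` under a surjection of `L` onto `ι → F`
which kills brackets, then the tensor square of `L` is that of `ι → F`. -/
theorem isLieAbelian_and_nonempty_equiv_of_surjective {ι : Type*} [Fintype ι]
    (π : L →ₗ[F] (ι → F)) (hsurj : Function.Surjective π) (hπ : ∀ x y : L, π ⁅x, y⁆ = 0)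
    (hl : ∀ x y, π x = 0 → tmul F x y = 0) (hr : ∀ x y, π y = 0 → tmul F x y = 0) :
    IsLieAbelian (LieTensorSquare F L) ∧
      Nonempty (LieTensorSquare F L ≃ₗ[F] (ι × ι → F)) := by
  classical
  choose s hs using fun i : ι => hsurj (Pi.single i 1)
  let f : L →ₗ[F] L →ₗ[F] (ι × ι → F) :=
    LinearMap.mk₂ F (fun x y k => π x k.1 * π y k.2)
      (fun _ _ _ => by ext; simp [add_mul]) (fun _ _ _ => by ext; simp [mul_assoc])
      (fun _ _ _ => by ext; simp [mul_add]) (fun _ _ _ => by ext; simp [mul_left_comm])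
  have hf (x y k) : f x y k = π x k.1 * π y k.2 := rfl
  have hdecomp (x : L) : π (x - ∑ i, π x i • s i) = 0 := by
    ext j
    simp [hs, Pi.single_apply]
  refine isLieAbelian_and_nonempty_equiv f (fun k => s k.1) (fun k => s k.2) ?_ ?_ ?_ ?_ ?_
  · intros; ext; simp [hf, hπ]
  · intros; ext; simp [hf, hπ]
  · intros; ext; simp [hf, hπ]
  · rintro ⟨i, j⟩
    ext ⟨i', j'⟩
    by_cases h : i' = i <;> by_cases h' : j' = j <;> simp [hf, hs, h, h']
  · intro x y
    have hx := hl _ y (hdecomp x)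
    rw [← tmulₗ_apply, map_sub, LinearMap.sub_apply, sub_eq_zero] at hx
    have hy (i : ι) := hr (s i) _ (hdecomp y)
    simp only [← tmulₗ_apply, map_sub, sub_eq_zero] at hy
    simp only [← tmulₗ_apply, hf]
    rw [hx, Fintype.sum_prod_type]
    simp [hy, Finset.smul_sum, mul_smul]

end LieTensorSquare

/-- Abelian Lie algebras which are linearly isomorphic are isomorphic. -/
def LinearEquiv.toLieEquivOfIsLieAbelian {F L L' : Type*} [CommRing F] [LieRing L] [LieAlgebra F L]
    [LieRing L'] [LieAlgebra F L'] [IsLieAbelian L] [IsLieAbelian L'] (e : L ≃ₗ[F] L') :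
    L ≃ₗ⁅F⁆ L' :=
  { e with
    map_lie' := fun {x y} => by
      change e ⁅x, y⁆ = ⁅e x, e y⁆
      rw [trivial_lie_zero, trivial_lie_zero, map_zero] }

/-! ### Heisenberg Lie algebras and their tensor squares. -/

namespace IsHeisenberg

open LieTensorSquare

variable {F L : Type*} [Field F] [LieRing L] [LieAlgebra F L]

theorem lie_mem_derivedIdeal (x y : L) : ⁅x, y⁆ ∈ derivedIdeal F L :=
  LieSubmodule.lie_mem_lie (LieSubmodule.mem_top x) (LieSubmodule.mem_top y)

theorem lie_lie_eq_zero (hL : IsHeisenberg F L) (x y w : L) : ⁅w, ⁅x, y⁆⁆ = 0 := by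
  have h := lie_mem_derivedIdeal (F := F) x y
  rw [hL.derivedIdeal_eq_center] at h
  exact h w

theorem exists_lie_ne_zero (hL : IsHeisenberg F L) : ∃ x y : L, ⁅x, y⁆ ≠ 0 := by
  by_contra! h
  have : derivedIdeal F L = ⊥ := by
    rw [LieSubmodule.lie_eq_bot_iff]
    exact fun x _ y _ => h x y
  have h1 := hL.finrank_derivedIdeal
  rw [this] at h1
  exact zero_ne_one ((finrank_bot F L).symm.trans h1)

theorem exists_smul_eq (hL : IsHeisenberg F L) {z w : L} (hz : z ∈ derivedIdeal F L)
    (hz0 : z ≠ 0) (hw : w ∈ derivedIdeal F L) : ∃ c : F, c • z = w := by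
  obtain ⟨c, hc⟩ := exists_smul_eq_of_finrank_eq_one hL.finrank_derivedIdeal
    (x := ⟨z, hz⟩) (by simpa [Subtype.ext_iff] using hz0) ⟨w, hw⟩
  exact ⟨c, congrArg Subtype.val hc⟩

theorem exists_lie_eq_smul (hL : IsHeisenberg F L) {z : L} (hz : z ∈ derivedIdeal F L)
    (hz0 : z ≠ 0) : ∃ ω : L →ₗ[F] L →ₗ[F] F, ∀ x y : L, ⁅x, y⁆ = ω x y • z := by
  choose c hc using fun x y : L => hL.exists_smul_eq hz hz0 (lie_mem_derivedIdeal x y)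
  have hinj := smul_left_injective F hz0
  refine ⟨LinearMap.mk₂ F c (fun _ _ _ => hinj ?_) (fun _ _ _ => hinj ?_) (fun _ _ _ => hinj ?_)
    (fun _ _ _ => hinj ?_), fun x y => (hc x y).symm⟩ <;>
  simp [hc, add_smul, mul_smul]

/-- In a Heisenberg Lie algebra of dimension at least `5`, every centralizer is non-abelian. -/
theorem exists_lie_ne_zero_of_lie_eq_zero (hL : IsHeisenberg F L) (hdim : 4 ≤ Module.finrank F L)
    (y : L) : ∃ a b : L, ⁅a, y⁆ = 0 ∧ ⁅b, y⁆ = 0 ∧ ⁅a, b⁆ ≠ 0 := by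
  by_cases hy : ∀ u : L, ⁅u, y⁆ = 0
  · obtain ⟨a, b, hab⟩ := hL.exists_lie_ne_zero
    exact ⟨a, b, hy a, hy b, hab⟩
  push Not at hy
  obtain ⟨u, hu⟩ := hy
  have := hL.finiteDimensional
  obtain ⟨ω, hω⟩ := hL.exists_lie_eq_smul (lie_mem_derivedIdeal u y) hu
  have huy : ω u y = 1 := by
    have := hω u y
    exact smul_left_injective F hu (by simpa using this.symm)
  -- The kernel consists of the elements commuting with `y` and `u`. Its dimension is at least 4 -
  -- 2, so it is not contained in the one-dimensional centre.
  let φ : L →ₗ[F] F × F := (ω.flip y).prod (ω.flip u)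
  obtain ⟨c, hc, hc'⟩ : ∃ c ∈ LinearMap.ker φ, c ∉ (LieAlgebra.center F L).toSubmodule := by
    by_contra! h
    have h1 := Submodule.finrank_mono (show LinearMap.ker φ ≤ _ from h)
    have h2 := hL.finrank_derivedIdeal
    rw [hL.derivedIdeal_eq_center] at h2
    have h3 := LinearMap.finrank_range_add_finrank_ker φ
    have h4 := Submodule.finrank_le (LinearMap.range φ)
    have h5 : Module.finrank F (F × F) = 2 := by simp
    change _ ≤ Module.finrank F (LieAlgebra.center F L) at h1
    omega
  have hcy : ω c y = 0 := congrArg Prod.fst hc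
  have hcu : ω c u = 0 := congrArg Prod.snd hc
  obtain ⟨w, hw⟩ : ∃ w : L, ⁅c, w⁆ ≠ 0 := by
    by_contra! h
    exact hc' fun w => by rw [← lie_skew, h, neg_zero]
  -- Subtracting this multiple of `u` makes `w` commute with `y`, and leaves the bracket with `c`
  -- unchanged because `c` commutes with `u`.
  refine ⟨c, w - ω w y • u, ?_, ?_, ?_⟩
  · rw [hω, hcy, zero_smul]
  · rw [hω]; simp [huy]
  · rw [hω] at hw ⊢
    simpa [hcu] using hw

theorem tmul_eq_zero (hL : IsHeisenberg F L) (hdim : 4 ≤ Module.finrank F L) {z : L}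
    (hz : z ∈ derivedIdeal F L) (y : L) : tmul F z y = 0 ∧ tmul F y z = 0 := by
  obtain ⟨a, b, ha, hb, hab⟩ := hL.exists_lie_ne_zero_of_lie_eq_zero hdim y
  obtain ⟨c, rfl⟩ := hL.exists_smul_eq (lie_mem_derivedIdeal a b) hab hz
  have h0l : tmul F (0 : L) = 0 := funext fun y => by simp [← tmulₗ_apply]
  have h0r (x : L) : tmul F x 0 = 0 := by simp [← tmulₗ_apply]
  constructor
  · rw [tmul_smul_left, tmul_lie_left, ha, hb, h0r, h0r, sub_zero, smul_zero]
  · rw [tmul_smul_right, tmul_lie_right, ha, hb, h0l]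
    simp

theorem isLieAbelian_tensorSquare_and_nonempty_equiv (hL : IsHeisenberg F L) (m : ℕ)
    (hm : 2 ≤ m) (hdim : Module.finrank F L = 2 * m + 1) :
    (IsLieAbelian (LieTensorSquare F L) ∧
      Nonempty (LieTensorSquare F L ≃ₗ[F] (Fin (2 * m) × Fin (2 * m) → F))) ∧
    (IsLieAbelian (LieTensorSquare F (L ⧸ derivedIdeal F L)) ∧
      Nonempty (LieTensorSquare F (L ⧸ derivedIdeal F L) ≃ₗ[F]
        (Fin (2 * m) × Fin (2 * m) → F))) := by
  have := hL.finiteDimensional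
  have hV : Module.finrank F (L ⧸ derivedIdeal F L) = 2 * m := by
    have h := Submodule.finrank_quotient_add_finrank (derivedIdeal F L).toSubmodule
    have h2 := hL.finrank_derivedIdeal
    change Module.finrank F (L ⧸ derivedIdeal F L) + Module.finrank F (derivedIdeal F L) = _ at h
    omega
  have : Module.Finite F (L ⧸ derivedIdeal F L) :=
    inferInstanceAs (Module.Finite F (L ⧸ (derivedIdeal F L).toSubmodule))
  let e : (L ⧸ derivedIdeal F L) ≃ₗ[F] (Fin (2 * m) → F) :=
    (Module.finBasisOfFinrankEq F _ hV).equivFun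
  let mk : L →ₗ[F] (L ⧸ derivedIdeal F L) := (derivedIdeal F L).toSubmodule.mkQ
  have hmk : Function.Surjective mk := Submodule.mkQ_surjective _
  have hmk0 (x : L) : mk x = 0 ↔ x ∈ derivedIdeal F L := Submodule.Quotient.mk_eq_zero _
  have hmk_lie (x y : L) : mk ⁅x, y⁆ = 0 := (hmk0 _).2 (lie_mem_derivedIdeal x y)
  constructor
  · refine isLieAbelian_and_nonempty_equiv_of_surjective (e.toLinearMap ∘ₗ mk)
      (e.surjective.comp hmk) (fun x y => by simp [hmk_lie]) ?_ ?_
    · intro x y hx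
      exact (hL.tmul_eq_zero (by omega) ((hmk0 x).1 (by simpa using hx)) y).1
    · intro x y hy
      exact (hL.tmul_eq_zero (by omega) ((hmk0 y).1 (by simpa using hy)) x).2
  -- The quotient is abelian and `e` is injective, so the same criterion applies.
  · refine isLieAbelian_and_nonempty_equiv_of_surjective e.toLinearMap e.surjective ?_ ?_ ?_
    · intro x y
      obtain ⟨x, rfl⟩ := hmk x
      obtain ⟨y, rfl⟩ := hmk y
      exact (congrArg e (hmk_lie x y)).trans (map_zero e)
    · intro x y hx
      obtain rfl : x = 0 := by simpa using hx
      simp [← tmulₗ_apply]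
    · intro x y hy
      obtain rfl : y = 0 := by simpa using hy
      simp [← tmulₗ_apply]

theorem exists_basis (hL : IsHeisenberg F L) (hdim : Module.finrank F L = 3) :
    ∃ b : Module.Basis (Fin 3) F L, ⁅b 0, b 1⁆ = b 2 ∧ ∀ x : L, ⁅x, b 2⁆ = 0 := by
  obtain ⟨x, y, hxy⟩ := hL.exists_lie_ne_zero
  have hli : LinearIndependent F ![x, y, ⁅x, y⁆] := by
    rw [Fintype.linearIndependent_iff]
    intro g hg
    simp only [Fin.sum_univ_three, Matrix.cons_val] at hg
    have h0 : g 0 = 0 := by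
      -- Bracketing with `y` kills the last two terms of the relation, as `⁅x, y⁆` is central.
      have := congrArg (fun t => ⁅t, y⁆) hg
      have h := hL.lie_lie_eq_zero x y y
      rw [← lie_skew, neg_eq_zero] at h
      simpa [h, hxy] using this
    have h1 : g 1 = 0 := by
      have := congrArg (fun t => ⁅x, t⁆) hg
      simpa [hL.lie_lie_eq_zero x y x, hxy] using this
    have h2 : g 2 = 0 := by simpa [h0, h1, hxy] using hg
    intro i
    fin_cases i <;> assumption
  have hb := coe_basisOfLinearIndependentOfCardEqFinrank hli (by simp [hdim])
  refine ⟨basisOfLinearIndependentOfCardEqFinrank hli (by simp [hdim]), ?_, ?_⟩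
  · simp [hb]
  · intro w
    simpa [hb] using hL.lie_lie_eq_zero x y w

theorem isLieAbelian_tensorSquare_and_nonempty_equiv_of_finrank_eq_three (hL : IsHeisenberg F L)
    (hdim : Module.finrank F L = 3) :
    IsLieAbelian (LieTensorSquare F L) ∧ Nonempty (LieTensorSquare F L ≃ₗ[F] (Fin 6 → F)) := by
  obtain ⟨b, hb, hb2⟩ := hL.exists_basis hdim
  have hb2' (x : L) : ⁅b 2, x⁆ = 0 := by rw [← lie_skew, hb2, neg_zero]
  have hb' : ⁅b 1, b 0⁆ = -b 2 := by rw [← lie_skew, hb]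
  have hexp (x : L) : x = b.repr x 0 • b 0 + b.repr x 1 • b 1 + b.repr x 2 • b 2 := by
    conv_lhs => rw [← b.sum_repr x, Fin.sum_univ_three]
  have hlie (x y : L) :
      ⁅x, y⁆ = (b.repr x 0 * b.repr y 1 - b.repr x 1 * b.repr y 0) • b 2 := by
    conv_lhs => rw [hexp x, hexp y]
    simp only [add_lie, lie_add, smul_lie, lie_smul, lie_self, hb, hb', hb2, hb2']
    module
  have h0 (x y : L) : b.repr ⁅x, y⁆ 0 = 0 := by rw [hlie]; simp
  have h1 (x y : L) : b.repr ⁅x, y⁆ 1 = 0 := by rw [hlie]; simp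
  have h2 (x y : L) :
      b.repr ⁅x, y⁆ 2 = b.repr x 0 * b.repr y 1 - b.repr x 1 * b.repr y 0 := by
    rw [hlie]; simp
  obtain ⟨f, hf⟩ : ∃ f : L →ₗ[F] L →ₗ[F] (Fin 6 → F), ∀ x y, f x y =
      ![b.repr x 0 * b.repr y 0, b.repr x 0 * b.repr y 1, b.repr x 1 * b.repr y 0,
        b.repr x 1 * b.repr y 1, b.repr x 2 * b.repr y 0 - b.repr x 0 * b.repr y 2,
        b.repr x 2 * b.repr y 1 - b.repr x 1 * b.repr y 2] := by
    let f₀ (x y : L) : Fin 6 → F :=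
      ![b.repr x 0 * b.repr y 0, b.repr x 0 * b.repr y 1, b.repr x 1 * b.repr y 0,
        b.repr x 1 * b.repr y 1, b.repr x 2 * b.repr y 0 - b.repr x 0 * b.repr y 2,
        b.repr x 2 * b.repr y 1 - b.repr x 1 * b.repr y 2]
    refine ⟨LinearMap.mk₂ F f₀ ?_ ?_ ?_ ?_, fun x y => rfl⟩ <;> intros <;> ext k <;>
      fin_cases k <;> simp [f₀] <;> ring
  have h0l (y : L) : tmul F (0 : L) y = 0 := by simp [← tmulₗ_apply]
  have h0r (x : L) : tmul F x 0 = 0 := by simp [← tmulₗ_apply]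
  have hz (w : L) : tmul F (b 2) w = tmul F (b 0) ⁅b 1, w⁆ - tmul F (b 1) ⁅b 0, w⁆ := by
    rw [← tmul_lie_left, hb]
  have hneg (x y : L) : tmul F x (-y) = -tmul F x y := by simp [← tmulₗ_apply]
  have h02 : tmul F (b 0) (b 2) = -tmul F (b 2) (b 0) := by
    rw [hz (b 0), lie_self, h0r, hb', hneg]; simp
  have h12 : tmul F (b 1) (b 2) = -tmul F (b 2) (b 1) := by
    rw [hz (b 1), lie_self, h0r, hb]; simp
  -- This uses centrality of `b 2` rather than antisymmetry, so it also holds in characteristic 2.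
  have h22 : tmul F (b 2) (b 2) = 0 := by
    rw [hz (b 2), hb2, hb2, h0r, h0r, sub_zero]
  refine isLieAbelian_and_nonempty_equiv f ![b 0, b 0, b 1, b 1, b 2, b 2]
    ![b 0, b 1, b 0, b 1, b 0, b 1] ?_ ?_ ?_ ?_ ?_
  · intro x x' y
    ext k
    fin_cases k <;> simp [hf, h0, h1, h2] <;> ring
  · intro x y y'
    ext k
    fin_cases k <;> simp [hf, h0, h1, h2] <;> ring
  · intro x y x' y'
    ext k
    fin_cases k <;> simp [hf, h0, h1]
  · intro k
    fin_cases k <;> simp [hf] <;> ext j <;> fin_cases j <;> rfl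
  · intro x y
    conv_lhs => rw [hexp x, hexp y]
    simp only [Fin.sum_univ_six, hf, Matrix.cons_val, tmul_add_left, tmul_add_right,
      tmul_smul_left, tmul_smul_right, h02, h12, h22]
    module

end IsHeisenberg

/-- `L` is the Heisenberg Lie algebra `H(m)`, of dimension `2m + 1`, over an arbitrary field. -/
theorem proposition3p3 {F L : Type*} [Field F] [LieRing L] [LieAlgebra F L] (m : ℕ)
    (hL : IsHeisenberg F L) (hdim : Module.finrank F L = 2 * m + 1) :
    (2 ≤ m →
      Nonempty (LieTensorSquare F L ≃ₗ⁅F⁆ LieTensorSquare F (L ⧸ derivedIdeal F L)) ∧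
      Module.finrank F (LieTensorSquare F L) = 4 * m ^ 2) ∧
    (m = 1 →
      IsLieAbelian (LieTensorSquare F L) ∧
      Module.finrank F (LieTensorSquare F L) = 6) := by

  constructor
  · intro hm
    obtain ⟨⟨_, ⟨e⟩⟩, _, ⟨e'⟩⟩ := hL.isLieAbelian_tensorSquare_and_nonempty_equiv m hm hdim
    refine ⟨⟨(e.trans e'.symm).toLieEquivOfIsLieAbelian⟩, ?_⟩
    rw [e.finrank_eq, Module.finrank_fintype_fun_eq_card, Fintype.card_prod, Fintype.card_fin]
    ring
  · rintro rfl
    obtain ⟨h, ⟨e⟩⟩ :=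
      hL.isLieAbelian_tensorSquare_and_nonempty_equiv_of_finrank_eq_three hdim
    exact ⟨h, by rw [e.finrank_eq, Module.finrank_fintype_fun_eq_card, Fintype.card_fin]⟩
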